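/- For a pointed space $Y$ let $\Sigma Y$ be its reduced suspension, and for pointed spaces $Y,X$ let $[Y,X]$ be the set of pointed homotopy classes of basepoint preserving maps $Y\to X$; if $Y=\Sigma Y'$ is a suspension, $[Y,X]$ is a group through the suspension coordinate. For $n\ge 1$ let $F_n=\Sigma(T^{n-1}\sqcup *)$ be the $n$-th Fox space, where $T^{n-1}=(\mathbb R/\mathbb Z)^{n-1}$ and the added point $*$ is the basepoint. Let $n>1$. Let $s:F_{n-1}\to F_n$ be the map induced by the inclusion $T^{n-2}\to T^{n-1}$, $x\mapsto (x,0)$, let $r:F_n\to F_{n-1}$ be the map induced by the projection $T^{n-1}\to T^{n-2}$ forgetting the last coordinate, and let $q:F_n\to\Sigma F_{n-1}$ be the suspension of the map $T^{n-1}\sqcup *\to \Sigma(T^{n-2}\sqcup *)=F_{n-1}$, $(x,z)\mapsto[x,z]$, $*\mapsto *$, which collapses $T^{n-2}\sqcup *$ to the basepoint. Then there is a pointed homotopy equivalence $$h: F_n \;\simeq\; \Sigma F_{n-1}\vee F_{n-1}.$$ It is obtained from the natural semidirect product decomposition of $[F_n,X]$. That is, for every pointed space $X$ the sequence of groups $$1\to[\Sigma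 F_{n-1},X]\xrightarrow{\;q^*\;}[F_n,X]\xrightarrow{\;s^*\;}[F_{n-1},X]\to 1$$ is exact and split by $r^*$. There are an action of $[F_{n-1},X]$ on $[\Sigma F_{n-1},X]$ by automorphisms and a group isomorphism, natural in $X$, $$\Theta_X:[\Sigma F_{n-1},X]\rtimes[F_{n-1},X]\xrightarrow{\;\cong\;}[F_n,X],\qquad \Theta_X(a,b)=q^*(a)\,r^*(b).$$ For all $X$ and all $c\in[\Sigma F_{n-1}\vee F_{n-1},X]$ one has $h^*(c)=\Theta_X(c|_{\Sigma F_{n-1}},c|_{F_{n-1}})$. -/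

import Mathlib

open scoped unitInterval

universe u v w

namespace FoxTorus

/-! ### Pointed spaces, pointed maps and pointed homotopy classes -/

/-- A pointed topological space. -/
structure PtdSpace : Type (u + 1) where
  /-- The underlying type. -/
  carrier : Type u
  /-- The topology. -/
  [top : TopologicalSpace carrier]
  /-- The basepoint. -/
  pt : carrier

instance : CoeSort PtdSpace.{u} (Type u) := ⟨PtdSpace.carrier⟩

instance (Y : PtdSpace.{u}) : TopologicalSpace Y := Y.top

/-- Basepoint preserving continuous maps. -/
structure PtdMap (Y : PtdSpace.{u}) (X : PtdSpace.{v}) where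
  /-- The underlying continuous map. -/
  toMap : C(Y, X)
  map_pt : toMap Y.pt = X.pt

namespace PtdMap

variable {Y : PtdSpace.{u}} {X : PtdSpace.{v}} {Z : PtdSpace.{w}}

instance : CoeFun (PtdMap Y X) (fun _ => Y → X) := ⟨fun f => f.toMap⟩

theorem ext {f g : PtdMap Y X} (h : ∀ y, f y = g y) : f = g := by
  cases f; cases g
  congr 1
  exact ContinuousMap.ext h

/-- The identity map. -/
def id (Y : PtdSpace.{u}) : PtdMap Y Y := ⟨ContinuousMap.id Y, rfl⟩

/-- The constant map at the basepoint. -/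
def const (Y : PtdSpace.{u}) (X : PtdSpace.{v}) : PtdMap Y X :=
  ⟨ContinuousMap.const Y X.pt, rfl⟩

/-- `g.comp f` is the map `y ↦ g (f y)`. -/
def comp (g : PtdMap X Z) (f : PtdMap Y X) : PtdMap Y Z :=
  ⟨g.toMap.comp f.toMap, by simp [f.map_pt, g.map_pt]⟩

/-- Homotopy through basepoint preserving maps. -/
def Homotopic (f g : PtdMap Y X) : Prop :=
  f.toMap.HomotopicRel g.toMap {Y.pt}

/-- The map `h` is a pointed homotopy equivalence. -/
def IsHomotopyEquiv (h : PtdMap Y X) : Prop :=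
  ∃ k : PtdMap X Y, (k.comp h).Homotopic (PtdMap.id Y) ∧ (h.comp k).Homotopic (PtdMap.id X)

/-- Pointed homotopy as an equivalence relation. -/
instance homotopySetoid (Y : PtdSpace.{u}) (X : PtdSpace.{v}) : Setoid (PtdMap Y X) where
  r := Homotopic
  iseqv := ⟨fun f => ContinuousMap.HomotopicRel.refl f.toMap, fun h => h.symm,
    fun h h' => h.trans h'⟩

theorem Homotopic.comp_left {f g : PtdMap Y X} (h : f.Homotopic g) (k : PtdMap X Z) :
    (k.comp f).Homotopic (k.comp g) :=
  ContinuousMap.HomotopicRel.comp_continuousMap h k.toMap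

theorem Homotopic.comp_right {f g : PtdMap X Z} (h : f.Homotopic g) (k : PtdMap Y X) :
    (f.comp k).Homotopic (g.comp k) := by
  obtain ⟨H⟩ := h
  refine ⟨⟨⟨⟨fun p => H (p.1, k p.2), ?_⟩, ?_, ?_⟩, ?_⟩⟩
  · have := k.toMap.continuous
    fun_prop
  · intro y
    exact H.apply_zero (k y)
  · intro y
    exact H.apply_one (k y)
  · intro t y hy
    rw [Set.mem_singleton_iff] at hy
    subst hy
    have := H.prop' t (k Y.pt) (by rw [Set.mem_singleton_iff]; exact k.map_pt)
    exact this

end PtdMap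

/-- The set `[Y, X]` of pointed homotopy classes of basepoint preserving maps. -/
def HoClass (Y : PtdSpace.{u}) (X : PtdSpace.{v}) : Type (max u v) :=
  Quotient (PtdMap.homotopySetoid Y X)

namespace HoClass

variable {Y : PtdSpace.{u}} {X : PtdSpace.{v}} {Z : PtdSpace.{w}}

/-- The class of a map. -/
def mk (f : PtdMap Y X) : HoClass Y X := Quotient.mk _ f

/-- `pull k : [X, Z] → [Y, Z]` is precomposition with `k : Y → X`, usually written `k^*`. -/
def pull (k : PtdMap Y X) : HoClass X Z → HoClass Y Z :=
  Quotient.map (fun f => f.comp k) (fun _ _ h => h.comp_right k)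

/-- `push k : [Y, X] → [Y, Z]` is postcomposition with `k : X → Z`, usually written `k_*`. -/
def push (k : PtdMap X Z) : HoClass Y X → HoClass Y Z :=
  Quotient.map (fun f => k.comp f) (fun _ _ h => h.comp_left k)

end HoClass

/-! ### Collapsing a subset to a point; suspensions, wedges, disjoint basepoints -/

/-- The equivalence relation that identifies all points of `S` with one another. -/
def collapseSetoid {Z : Type u} (S : Set Z) : Setoid Z where
  r a b := a = b ∨ (a ∈ S ∧ b ∈ S)
  iseqv := by
    refine ⟨fun a => Or.inl rfl, ?_, ?_⟩
    · rintro a b (h | h)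
      · exact Or.inl h.symm
      · exact Or.inr h.symm
    · rintro a b c (rfl | h) (rfl | h')
      · exact Or.inl rfl
      · exact Or.inr h'
      · exact Or.inr h
      · exact Or.inr ⟨h.1, h'.2⟩

/-- The quotient space `Z / S`, with the quotient topology. -/
abbrev Collapse {Z : Type u} (S : Set Z) : Type u := Quotient (collapseSetoid S)

/-- The subset `Y × {0, 1} ∪ {pt} × [0, 1]` of `Y × [0, 1]`. -/
def suspSet (Y : PtdSpace.{u}) : Set (Y × I) := {p | p.1 = Y.pt ∨ p.2 = 0 ∨ p.2 = 1}

/-- The reduced suspension `ΣY`: the quotient of `Y × [0, 1]` by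
`Y × {0, 1} ∪ {pt} × [0, 1]`. -/
def Susp (Y : PtdSpace.{u}) : PtdSpace.{u} where
  carrier := Collapse (suspSet Y)
  pt := Quotient.mk _ (Y.pt, 0)

/-- The wedge `A ∨ B`: the disjoint union with the two basepoints identified. -/
def Wedge (A : PtdSpace.{u}) (B : PtdSpace.{v}) : PtdSpace.{max u v} where
  carrier := Collapse ({Sum.inl A.pt, Sum.inr B.pt} : Set (A ⊕ B))
  pt := Quotient.mk _ (Sum.inl A.pt)

/-- The space `W ⊔ *` with the added point as basepoint. -/
def AddPt (W : Type u) [TopologicalSpace W] : PtdSpace.{u} where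
  carrier := W ⊕ Unit
  pt := Sum.inr ()

namespace Wedge

/-- The inclusion `A → A ∨ B`. -/
def inl (A : PtdSpace.{u}) (B : PtdSpace.{v}) : PtdMap A (Wedge A B) where
  toMap := ⟨fun a => Quotient.mk _ (Sum.inl a),
    continuous_quotient_mk'.comp continuous_inl⟩
  map_pt := rfl

/-- The inclusion `B → A ∨ B`. -/
def inr (A : PtdSpace.{u}) (B : PtdSpace.{v}) : PtdMap B (Wedge A B) where
  toMap := ⟨fun b => Quotient.mk _ (Sum.inr b),
    continuous_quotient_mk'.comp continuous_inr⟩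
  map_pt := Quotient.sound (Or.inr ⟨by simp, by simp⟩)

end Wedge

namespace AddPt

/-- The pointed map `V ⊔ * → W ⊔ *` induced by a continuous map `V → W`. -/
def map {V : Type u} {W : Type v} [TopologicalSpace V] [TopologicalSpace W] (f : C(V, W)) :
    PtdMap (AddPt V) (AddPt W) where
  toMap := ⟨Sum.map f _root_.id, f.continuous.sumMap continuous_id⟩
  map_pt := rfl

end AddPt

namespace Susp

variable {Y : PtdSpace.{u}} {X : PtdSpace.{v}} {Z : PtdSpace.{w}}

/-- The point `[y, t]` of `ΣY`. -/
def point (Y : PtdSpace.{u}) (y : Y) (t : I) : Susp Y :=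
  Quotient.mk (collapseSetoid (suspSet Y)) (y, t)

theorem continuous_point : Continuous fun p : Y × I => point Y p.1 p.2 :=
  continuous_quotient_mk'

theorem point_eq_pt {y : Y} {t : I} (h : y = Y.pt ∨ t = 0 ∨ t = 1) :
    point Y y t = (Susp Y).pt :=
  Quotient.sound (Or.inr ⟨h, Or.inl rfl⟩)

/-- The loop `t ↦ f [y, t]`. -/
def loop (f : PtdMap (Susp Y) X) (y : Y) : Path X.pt X.pt where
  toFun t := f (point Y y t)
  continuous_toFun := f.toMap.continuous.comp
    (continuous_point.comp (Continuous.prodMk continuous_const continuous_id))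
  source' := by
    rw [point_eq_pt (Or.inr (Or.inl rfl))]
    exact f.map_pt
  target' := by
    rw [point_eq_pt (Or.inr (Or.inr rfl))]
    exact f.map_pt

theorem continuous_loop (f : PtdMap (Susp Y) X) : Continuous ↿(loop f) :=
  f.toMap.continuous.comp continuous_point

theorem loop_pt (f : PtdMap (Susp Y) X) : loop f Y.pt = Path.refl X.pt := by
  ext t
  change f (point Y Y.pt t) = X.pt
  rw [point_eq_pt (Or.inl rfl)]
  exact f.map_pt

/-- The map `ΣY → X`, `[y, t] ↦ γ y t`, given by a continuous family of loops that is constant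
at the basepoint of `Y`. -/
def ofLoops (γ : Y → Path X.pt X.pt) (hγ : Continuous ↿γ) (hpt : γ Y.pt = Path.refl X.pt) :
    PtdMap (Susp Y) X where
  toMap := ⟨Quotient.lift (fun p : Y × I => γ p.1 p.2) (by
      have key : ∀ p : Y × I, p ∈ suspSet Y → γ p.1 p.2 = X.pt := by
        rintro ⟨y, t⟩ (h | h | h)
        · obtain rfl : y = Y.pt := h
          simp [hpt]
        · obtain rfl : t = 0 := h
          simp
        · obtain rfl : t = 1 := h
          simp
      rintro a b (rfl | ⟨ha, hb⟩)
      · rfl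
      · exact (key a ha).trans (key b hb).symm), Continuous.quotient_lift hγ _⟩
  map_pt := (γ Y.pt).source

theorem loop_ofLoops (γ : Y → Path X.pt X.pt) (hγ : Continuous ↿γ)
    (hpt : γ Y.pt = Path.refl X.pt) (y : Y) : loop (ofLoops γ hγ hpt) y = γ y := rfl

theorem ext_loop {f g : PtdMap (Susp Y) X} (h : ∀ y, loop f y = loop g y) : f = g := by
  refine PtdMap.ext fun p => ?_
  induction p using Quotient.inductionOn with
  | h p => exact congrArg (fun γ : Path X.pt X.pt => γ p.2) (h p.1)

theorem homotopic_of_loops {f g : PtdMap (Susp Y) X} (Γ : I × Y → Path X.pt X.pt)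
    (hΓ : Continuous ↿Γ) (hpt : ∀ s, Γ (s, Y.pt) = Path.refl X.pt)
    (h0 : ∀ y, Γ (0, y) = loop f y) (h1 : ∀ y, Γ (1, y) = loop g y) : f.Homotopic g := by
  have hq : Topology.IsQuotientMap (Quotient.mk (collapseSetoid (suspSet Y))) :=
    isQuotientMap_quotient_mk'
  let F : I → PtdMap (Susp Y) X := fun s =>
    ofLoops (fun y => Γ (s, y))
      (hΓ.comp (f := fun p : Y × I => ((s, p.1), p.2)) (by fun_prop)) (hpt s)
  have hF0 : F 0 = f := ext_loop h0
  have hF1 : F 1 = g := ext_loop h1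
  refine ⟨⟨⟨⟨fun p => F p.1 p.2, ?_⟩, ?_, ?_⟩, ?_⟩⟩
  · refine hq.continuous_lift_prod_right ?_
    exact hΓ.comp (f := fun p : I × (Y × I) => ((p.1, p.2.1), p.2.2)) (by fun_prop)
  · intro p
    change F 0 p = f p
    rw [hF0]
  · intro p
    change F 1 p = g p
    rw [hF1]
  · intro s p hp
    rw [Set.mem_singleton_iff] at hp
    subst hp
    exact (F s).map_pt.trans f.map_pt.symm

theorem loops_of_homotopic {f g : PtdMap (Susp Y) X} (h : f.Homotopic g) :
    ∃ Γ : I × Y → Path X.pt X.pt, Continuous ↿Γ ∧ (∀ s, Γ (s, Y.pt) = Path.refl X.pt) ∧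
      (∀ y, Γ (0, y) = loop f y) ∧ (∀ y, Γ (1, y) = loop g y) := by
  obtain ⟨H⟩ := h
  have hc : Continuous fun p : (I × Y) × I => H (p.1.1, point Y p.1.2 p.2) :=
    H.continuous.comp (continuous_fst.fst.prodMk
      (continuous_point.comp (continuous_fst.snd.prodMk continuous_snd)))
  have hH : ∀ s, H (s, (Susp Y).pt) = X.pt := fun s =>
    (H.prop' s (Susp Y).pt rfl).trans f.map_pt
  refine ⟨fun q => ⟨⟨fun t => H (q.1, point Y q.2 t),
    hc.comp (f := fun t => (q, t)) (by fun_prop)⟩, ?_, ?_⟩, hc, ?_, ?_, ?_⟩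
  · change H (q.1, point Y q.2 0) = X.pt
    rw [point_eq_pt (Or.inr (Or.inl rfl)), hH]
  · change H (q.1, point Y q.2 1) = X.pt
    rw [point_eq_pt (Or.inr (Or.inr rfl)), hH]
  · intro s
    ext t
    change H (s, point Y Y.pt t) = X.pt
    rw [point_eq_pt (Or.inl rfl), hH]
  · intro y
    ext t
    exact H.apply_zero _
  · intro y
    ext t
    exact H.apply_one _

/-- The suspension `Σk : ΣY → ΣZ`, `[y, t] ↦ [k y, t]`, of a pointed map. -/
def map (k : PtdMap Y Z) : PtdMap (Susp Y) (Susp Z) :=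
  ofLoops (fun y => loop (PtdMap.id (Susp Z)) (k y))
    ((continuous_loop (PtdMap.id (Susp Z))).comp
      (k.toMap.continuous.prodMap continuous_id))
    (by rw [k.map_pt]; exact loop_pt _)

/-! ### The group `[ΣY, X]` -/

/-- The sum of two maps out of a suspension:
`[y, t] ↦ f [y, 2t]` for `t ≤ 1/2` and `[y, t] ↦ g [y, 2t - 1]` for `t ≥ 1/2`. -/
noncomputable def mulMap (f g : PtdMap (Susp Y) X) : PtdMap (Susp Y) X :=
  ofLoops (fun y => (loop f y).trans (loop g y))
    (Path.trans_continuous_family _ (continuous_loop f) _ (continuous_loop g))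
    (by rw [loop_pt, loop_pt, Path.refl_trans_refl])

/-- The reversed map `[y, t] ↦ f [y, 1 - t]`. -/
def invMap (f : PtdMap (Susp Y) X) : PtdMap (Susp Y) X :=
  ofLoops (fun y => (loop f y).symm)
    (Path.symm_continuous_family _ (continuous_loop f))
    (by rw [loop_pt, Path.refl_symm])

theorem mulMap_homotopic {f f' g g' : PtdMap (Susp Y) X} (hf : f.Homotopic f')
    (hg : g.Homotopic g') : (mulMap f g).Homotopic (mulMap f' g') := by
  obtain ⟨Γ, hΓ, hp, h0, h1⟩ := loops_of_homotopic hf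
  obtain ⟨Δ, hΔ, hp', h0', h1'⟩ := loops_of_homotopic hg
  refine homotopic_of_loops (fun q => (Γ q).trans (Δ q))
    (Path.trans_continuous_family _ hΓ _ hΔ) ?_ ?_ ?_
  · intro s
    simp only [hp, hp', Path.refl_trans_refl]
  · intro y
    simp only [h0, h0']
    rfl
  · intro y
    simp only [h1, h1']
    rfl

theorem invMap_homotopic {f f' : PtdMap (Susp Y) X} (hf : f.Homotopic f') :
    (invMap f).Homotopic (invMap f') := by
  obtain ⟨Γ, hΓ, hp, h0, h1⟩ := loops_of_homotopic hf
  refine homotopic_of_loops (fun q => (Γ q).symm) (Path.symm_continuous_family _ hΓ) ?_ ?_ ?_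
  · intro s
    simp only [hp, Path.refl_symm]
  · intro y
    simp only [h0]
    rfl
  · intro y
    simp only [h1]
    rfl

theorem homotopic_of_reparam {f g : PtdMap (Susp Y) X} (θ : I → I) (hθ : Continuous θ)
    (θ0 : θ 0 = 0) (θ1 : θ 1 = 1) (h : ∀ y, loop g y = (loop f y).reparam θ hθ θ0 θ1) :
    f.Homotopic g := by
  let H := fun y => Path.Homotopy.reparam (loop f y) θ hθ θ0 θ1
  refine homotopic_of_loops (fun q => (H q.2).eval q.1) ?_ ?_ ?_ ?_
  · refine (continuous_loop f).comp (f := fun p : (I × Y) × I => (p.1.2, (⟨_, _⟩ : I))) ?_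
    refine Continuous.prodMk (by fun_prop) (Continuous.subtype_mk ?_ _)
    fun_prop
  · intro s
    ext t
    change loop f Y.pt _ = X.pt
    rw [loop_pt]
    rfl
  · intro y
    exact (H y).eval_zero
  · intro y
    exact ((H y).eval_one).trans (h y).symm

theorem mulMap_assoc (f g h : PtdMap (Susp Y) X) :
    (mulMap f (mulMap g h)).Homotopic (mulMap (mulMap f g) h) :=
  homotopic_of_reparam _ _ _ _
    (fun y => Path.Homotopy.trans_assoc_reparam (loop f y) (loop g y) (loop h y))

theorem mulMap_const (f : PtdMap (Susp Y) X) :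
    f.Homotopic (mulMap f (PtdMap.const _ _)) :=
  homotopic_of_reparam _ _ _ _ (fun y => Path.Homotopy.trans_refl_reparam (loop f y))

theorem mulMap_invMap (f : PtdMap (Susp Y) X) :
    (PtdMap.const _ _).Homotopic (mulMap f (invMap f)) := by
  let H := fun y => Path.Homotopy.reflTransSymm (loop f y)
  refine homotopic_of_loops (fun q => (H q.2).eval q.1) ?_ ?_ ?_ ?_
  · refine (continuous_loop f).comp (f := fun p : (I × Y) × I => (p.1.2, (⟨_, _⟩ : I))) ?_
    refine Continuous.prodMk (by fun_prop) (Continuous.subtype_mk ?_ _)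
    exact Path.Homotopy.continuous_reflTransSymmAux.comp (by fun_prop)
  · intro s
    ext t
    change loop f Y.pt _ = X.pt
    rw [loop_pt]
    rfl
  · intro y
    exact (H y).eval_zero
  · intro y
    exact (H y).eval_one

instance : One (HoClass (Susp Y) X) := ⟨HoClass.mk (PtdMap.const _ _)⟩

noncomputable instance : Mul (HoClass (Susp Y) X) :=
  ⟨Quotient.map₂ mulMap (fun _ _ h _ _ h' => mulMap_homotopic h h')⟩

noncomputable instance : Inv (HoClass (Susp Y) X) :=
  ⟨Quotient.map invMap (fun _ _ h => invMap_homotopic h)⟩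

/-- The group structure on `[ΣY, X]` coming from the suspension coordinate. -/
noncomputable instance : Group (HoClass (Susp Y) X) :=
  Group.ofRightAxioms
    (by
      intro a b c
      induction a using Quotient.inductionOn
      induction b using Quotient.inductionOn
      induction c using Quotient.inductionOn
      exact (Quotient.sound (mulMap_assoc _ _ _)).symm)
    (by
      intro a
      induction a using Quotient.inductionOn
      exact (Quotient.sound (mulMap_const _)).symm)
    (by
      intro a
      induction a using Quotient.inductionOn
      exact (Quotient.sound (mulMap_invMap _)).symm)

/-- The homomorphism `(Σk)^* : [ΣZ, X] → [ΣY, X]`, for a pointed map `k : Y → Z`. -/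
noncomputable def pullHom (k : PtdMap Y Z) (X : PtdSpace.{v}) :
    HoClass (Susp Z) X →* HoClass (Susp Y) X :=
  MonoidHom.mk' (HoClass.pull (map k)) (by
    intro a b
    induction a using Quotient.inductionOn
    induction b using Quotient.inductionOn
    exact congrArg HoClass.mk (ext_loop fun _ => rfl))

end Susp

/-! ### Tori and Fox spaces -/

/-- The torus `T^k`, the product of `k` circles `ℝ/ℤ`. -/
abbrev Torus (k : ℕ) : Type := Fin k → UnitAddCircle

/-- The Fox space `F_n = Σ(T^{n-1} ⊔ *)`, for `n ≥ 1`. -/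
abbrev FoxSpace (n : ℕ) : PtdSpace.{0} := Susp (AddPt (Torus (n - 1)))

/-- The projection `T^{n-1} → T^{n-2}` that forgets the last coordinate. -/
def torusProj (n : ℕ) : C(Torus (n - 1), Torus (n - 1 - 1)) :=
  ⟨fun x i => x (Fin.castLE (Nat.sub_le _ _) i), by fun_prop⟩

/-- The inclusion `T^{n-2} → T^{n-1}` whose last coordinate is the basepoint of the circle. -/
def torusIncl (n : ℕ) : C(Torus (n - 1 - 1), Torus (n - 1)) :=
  ⟨fun x i => if h : (i : ℕ) < n - 1 - 1 then x ⟨i, h⟩ else 0, by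
    refine continuous_pi fun i => ?_
    split_ifs <;> fun_prop⟩

/-- The last coordinate of a point of `T^{n-1}`, for `n > 1`. -/
def torusLast (n : ℕ) (hn : 1 < n) (x : Torus (n - 1)) : UnitAddCircle :=
  x ⟨n - 1 - 1, by omega⟩

/-- The representative in `[0, 1)` of a point of the circle `ℝ/ℤ`. -/
noncomputable def circleParam (z : UnitAddCircle) : I :=
  ⟨AddCircle.equivIco (1 : ℝ) 0 z, by
    have h := (AddCircle.equivIco (1 : ℝ) 0 z).2
    exact ⟨h.1, by simpa using h.2.le⟩⟩

theorem continuous_point_circleParam (Y : PtdSpace.{u}) :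
    Continuous fun p : Y × UnitAddCircle => Susp.point Y p.1 (circleParam p.2) := by
  have hq : IsOpenQuotientMap
      (Prod.map _root_.id ((↑) : ℝ → UnitAddCircle) : Y × ℝ → Y × UnitAddCircle) :=
    IsOpenQuotientMap.id.prodMap QuotientAddGroup.isOpenQuotientMap_mk
  refine hq.isQuotientMap.continuous_iff.mpr ?_
  let f : Y → ℝ → Susp Y := fun y t => Susp.point Y y (Set.projIcc 0 1 zero_le_one t)
  have hf : Continuous (Function.uncurry f) :=
    Susp.continuous_point.comp
      (continuous_fst.prodMk ((continuous_projIcc (h := zero_le_one)).comp continuous_snd))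
  have hf01 : ∀ y, f y 0 = f y 1 := by
    intro y
    simp only [f, Set.projIcc_left, Set.projIcc_right]
    exact (Susp.point_eq_pt (Or.inr (Or.inl rfl))).trans
      (Susp.point_eq_pt (Or.inr (Or.inr rfl))).symm
  convert ContinuousOn.comp_fract' hf.continuousOn hf01 using 1
  funext p
  change Susp.point Y p.1 (circleParam (p.2 : UnitAddCircle)) = _
  congr 1
  have h : ((circleParam (p.2 : UnitAddCircle) : I) : ℝ) = Int.fract p.2 := by
    change (AddCircle.equivIco (1 : ℝ) 0 (QuotientAddGroup.mk p.2) : ℝ) = _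
    rw [AddCircle.coe_equivIco_mk_apply]
    simp
  refine Subtype.ext ?_
  rw [h, Set.projIcc_of_mem zero_le_one ⟨Int.fract_nonneg _, (Int.fract_lt_one _).le⟩]

/-- The map `T^{n-1} ⊔ * → Σ(T^{n-2} ⊔ *) = F_{n-1}`, `x ↦ [(x_1, …, x_{n-2}), x_{n-1}]`, which
collapses `T^{n-2} ⊔ *` to the basepoint and identifies the quotient with `F_{n-1}`. -/
noncomputable def torusCollapse (n : ℕ) (hn : 1 < n) :
    PtdMap (AddPt (Torus (n - 1))) (FoxSpace (n - 1)) where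
  toMap := ⟨Sum.elim
      (fun x => Susp.point (AddPt (Torus (n - 1 - 1))) (Sum.inl (torusProj n x))
        (circleParam (torusLast n hn x)))
      (fun _ => (FoxSpace (n - 1)).pt), by
    refine Continuous.sumElim ?_ continuous_const
    refine (continuous_point_circleParam (AddPt (Torus (n - 1 - 1)))).comp
      (f := fun x => ((Sum.inl (torusProj n x) : AddPt (Torus (n - 1 - 1))),
        torusLast n hn x)) ?_
    exact (continuous_inl.comp (torusProj n).continuous).prodMk (continuous_apply _)⟩
  map_pt := rfl

/-- The homomorphism `[F_n, X] → [F_{n-1}, X]` induced by the inclusion `T^{n-2} → T^{n-1}`. -/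
noncomputable def foxRestrict (n : ℕ) (X : PtdSpace.{u}) :
    HoClass (FoxSpace n) X →* HoClass (FoxSpace (n - 1)) X :=
  Susp.pullHom (AddPt.map (torusIncl n)) X

/-- The homomorphism `[F_{n-1}, X] → [F_n, X]` induced by the projection `T^{n-1} → T^{n-2}`. -/
noncomputable def foxSection (n : ℕ) (X : PtdSpace.{u}) :
    HoClass (FoxSpace (n - 1)) X →* HoClass (FoxSpace n) X :=
  Susp.pullHom (AddPt.map (torusProj n)) X

/-- The homomorphism `[ΣF_{n-1}, X] → [F_n, X]` induced by the suspension of the collapse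
`T^{n-1} ⊔ * → F_{n-1}`. -/
noncomputable def foxKernelMap (n : ℕ) (hn : 1 < n) (X : PtdSpace.{u}) :
    HoClass (Susp (FoxSpace (n - 1))) X →* HoClass (FoxSpace n) X :=
  Susp.pullHom (torusCollapse n hn) X

end FoxTorus

open FoxTorus

/-!
Let `i : A → W` be a pointed cofibration with cofiber `q : W → Q` and retraction `r : W → A`.
The homotopy extension property of `i` gives exactness of `[ΣQ, X] → [ΣW, X] → [ΣA, X]`, which `r`
splits. The delicate point is that `q^*` is injective: a homotopy `f ∘ q ∼ g ∘ q` of maps into the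
loop space of `X` need not be constant on `A`, but dividing it by its own restriction along `i ∘ r`
makes its trace on `A` of the form `γ · γ⁻¹`. This trace contracts relative to its ends, so that by
homotopy extension the homotopy descends to `Q`. The resulting bijection of `[ΣW, X]` with
`[ΣQ, X] × [ΣA, X] = [ΣQ ∨ ΣA, X]` is induced by a map `ΣW → ΣQ ∨ ΣA`, the sum of `Σq` and `Σr`, so
this map is a homotopy equivalence by the Yoneda lemma. For the Fox spaces, `A ⊔ * → (A × S¹) ⊔ *`
is such a cofibration with cofiber `Σ(A ⊔ *)`.
-/

namespace FoxTorus

namespace PtdMap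

variable {Y : PtdSpace.{u}} {X : PtdSpace.{v}} {Z : PtdSpace.{w}}

theorem comp_const (k : PtdMap X Z) : k.comp (const Y X) = const Y Z :=
  ext fun _ => k.map_pt

end PtdMap

/-- The space of paths `[0, 1] → X` with the compact-open topology, based at the constant path.
Pointed homotopies between maps `Y → X` are encoded as pointed maps `Y → Paths X`. -/
def Paths (X : PtdSpace.{v}) : PtdSpace.{v} where
  carrier := C(I, X)
  pt := ContinuousMap.const I X.pt

namespace Paths

variable {Y : PtdSpace.{u}} {X : PtdSpace.{v}} {Z : PtdSpace.{w}}

/-- Evaluation of paths at the time `t`, which reads off a stage of a homotopy `Y → Paths X`. -/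
def eval (X : PtdSpace.{v}) (t : I) : PtdMap (Paths X) X where
  toMap := ⟨fun γ : C(I, X) => γ t, by fun_prop⟩
  map_pt := rfl

theorem continuous_eval (X : PtdSpace.{v}) :
    Continuous fun p : Paths X × I => eval X p.2 p.1 :=
  ContinuousEval.continuous_eval (F := C(I, X))

/-- The pointed map `Y → Paths X` with stages `F · t`. -/
def lift (F : Y → I → X) (hF : Continuous fun p : Y × I => F p.1 p.2)
    (hpt : ∀ t, F Y.pt t = X.pt) : PtdMap Y (Paths X) where
  toMap := ContinuousMap.curry ⟨fun p : Y × I => F p.1 p.2, hF⟩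
  map_pt := ContinuousMap.ext hpt

theorem hom_ext {H K : PtdMap Y (Paths X)} (h : ∀ t, (eval X t).comp H = (eval X t).comp K) :
    H = K :=
  PtdMap.ext fun y => ContinuousMap.ext fun t => congrArg (fun f : PtdMap Y X => f y) (h t)

/-- The pointed map `γ ↦ k ∘ γ` on path spaces. -/
def map (k : PtdMap X Z) : PtdMap (Paths X) (Paths Z) :=
  lift (fun γ t => k (eval X t γ)) (k.toMap.continuous.comp (continuous_eval X))
    fun _ => k.map_pt

/-- The exchange of the two parameters of a square in `X`. -/
def swap (X : PtdSpace.{v}) : PtdMap (Paths (Paths X)) (Paths (Paths X)) :=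
  lift (fun Γ t => map (eval X t) Γ)
    (ContinuousMap.continuous_of_continuous_uncurry _ <|
      (continuous_eval X).comp <| ((continuous_eval (Paths X)).comp <|
        continuous_fst.fst.prodMk continuous_snd).prodMk continuous_fst.snd)
    fun _ => rfl

end Paths

namespace PtdMap

variable {Y : PtdSpace.{u}} {X : PtdSpace.{v}}

theorem homotopic_iff_exists_paths {f g : PtdMap Y X} :
    f.Homotopic g ↔
      ∃ H : PtdMap Y (Paths X), (Paths.eval X 0).comp H = f ∧ (Paths.eval X 1).comp H = g := by
  constructor
  · rintro ⟨H⟩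
    refine ⟨Paths.lift (fun y t => H (t, y)) (by fun_prop) fun t => ?_, ?_, ?_⟩
    · exact (H.prop' t Y.pt rfl).trans f.map_pt
    · exact ext H.apply_zero
    · exact ext H.apply_one
  · rintro ⟨H, rfl, rfl⟩
    refine ⟨⟨⟨⟨fun p => Paths.eval X p.1 (H p.2), ?_⟩, fun _ => rfl, fun _ => rfl⟩, ?_⟩⟩
    · exact (Paths.continuous_eval X).comp
        ((H.toMap.continuous.comp continuous_snd).prodMk continuous_fst)
    · rintro t y rfl
      exact ((Paths.eval X t).comp H).map_pt.trans ((Paths.eval X 0).comp H).map_pt.symm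

end PtdMap

/-- The loop space of `X`, based at the constant loop. -/
def Loops (X : PtdSpace.{v}) : PtdSpace.{v} where
  carrier := Path X.pt X.pt
  pt := Path.refl X.pt

namespace Susp

variable {Y : PtdSpace.{u}} {X : PtdSpace.{v}}

/-- The adjunction between suspension and loop space. -/
def loopEquiv : PtdMap (Susp Y) X ≃ PtdMap Y (Loops X) where
  toFun f := ⟨⟨loop f, Path.continuous_uncurry_iff.mp (continuous_loop f)⟩, loop_pt f⟩
  invFun g := ofLoops g (Path.continuous_uncurry_iff.mpr g.toMap.continuous) g.map_pt
  left_inv _ := ext_loop fun _ => rfl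
  right_inv _ := rfl

theorem homotopic_iff_loopEquiv {f g : PtdMap (Susp Y) X} :
    f.Homotopic g ↔ (loopEquiv f).Homotopic (loopEquiv g) := by
  constructor
  · intro h
    obtain ⟨Γ, hΓ, hpt, h0, h1⟩ := loops_of_homotopic h
    refine ⟨⟨⟨⟨Γ, Path.continuous_uncurry_iff.mp hΓ⟩, h0, h1⟩, ?_⟩⟩
    rintro s y rfl
    exact (hpt s).trans (loop_pt f).symm
  · rintro ⟨H⟩
    exact homotopic_of_loops H (Path.continuous_uncurry_iff.mpr H.continuous)
      (fun s => (H.prop' s Y.pt rfl).trans (loop_pt f)) H.apply_zero H.apply_one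

end Susp

namespace Loops

variable {Y : PtdSpace.{u}} {X : PtdSpace.{v}}

/-- The pointwise quotient `y ↦ f y · (g y)⁻¹` of two maps into a loop space. -/
noncomputable def divide (f g : PtdMap Y (Loops X)) : PtdMap Y (Loops X) :=
  Susp.loopEquiv (Susp.mulMap (Susp.loopEquiv.symm f) (Susp.invMap (Susp.loopEquiv.symm g)))

theorem loopEquiv_mulMap_invMap (F G : PtdMap (Susp Y) X) :
    Susp.loopEquiv (Susp.mulMap F (Susp.invMap G)) =
      divide (Susp.loopEquiv F) (Susp.loopEquiv G) := by
  rw [divide, Equiv.symm_apply_apply, Equiv.symm_apply_apply]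

theorem divide_self_homotopic_const (f : PtdMap Y (Loops X)) :
    (divide f f).Homotopic (PtdMap.const Y (Loops X)) :=
  (Susp.homotopic_iff_loopEquiv.mp (Susp.mulMap_invMap (Susp.loopEquiv.symm f))).symm

theorem exists_divide_paths (H K : PtdMap Y (Paths (Loops X))) :
    ∃ L : PtdMap Y (Paths (Loops X)), ∀ t, (Paths.eval (Loops X) t).comp L =
      divide ((Paths.eval (Loops X) t).comp H) ((Paths.eval (Loops X) t).comp K) := by
  have heval (H : PtdMap Y (Paths (Loops X))) :
      Continuous fun p : Y × I => Paths.eval (Loops X) p.2 (H p.1) :=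
    (Paths.continuous_eval _).comp (H.toMap.continuous.prodMap continuous_id)
  exact ⟨Paths.lift
    (fun y t => divide ((Paths.eval _ t).comp H) ((Paths.eval _ t).comp K) y)
    (Path.continuous_trans.comp ((heval H).prodMk (Path.continuous_symm.comp (heval K))))
    fun t => (divide ((Paths.eval _ t).comp H) ((Paths.eval _ t).comp K)).map_pt, fun _ => rfl⟩

theorem exists_contraction_divide_self (M : PtdMap Y (Paths (Loops X)))
    (h0 : (Paths.eval (Loops X) 0).comp M = PtdMap.const _ _)
    (h1 : (Paths.eval (Loops X) 1).comp M = PtdMap.const _ _) :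
    ∃ K : PtdMap Y (Paths (Paths (Loops X))),
      (∀ t, (Paths.eval (Loops X) t).comp ((Paths.eval _ 0).comp K) =
        divide ((Paths.eval (Loops X) t).comp M) ((Paths.eval (Loops X) t).comp M)) ∧
      (Paths.eval _ 1).comp K = PtdMap.const _ _ ∧
      (Paths.map (Paths.eval _ 0)).comp K = PtdMap.const _ _ ∧
      (Paths.map (Paths.eval _ 1)).comp K = PtdMap.const _ _ := by
  obtain ⟨c, hc0, hc1⟩ := PtdMap.homotopic_iff_exists_paths.mp
    (divide_self_homotopic_const (PtdMap.id (Loops X)))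
  refine ⟨(Paths.swap (Loops X)).comp ((Paths.map c).comp M), fun t => ?_,
    Paths.hom_ext fun t => ?_, ?_, ?_⟩
  · exact congrArg (fun d => d.comp ((Paths.eval (Loops X) t).comp M)) hc0
  · exact congrArg (fun d => d.comp ((Paths.eval (Loops X) t).comp M)) hc1
  · exact (congrArg c.comp h0).trans (PtdMap.comp_const c)
  · exact (congrArg c.comp h1).trans (PtdMap.comp_const c)

end Loops

namespace Susp

variable {Y Y' Y'' : PtdSpace.{u}}

theorem pullHom_id (Y : PtdSpace.{u}) (X : PtdSpace.{v}) :
    pullHom (PtdMap.id Y) X = MonoidHom.id _ := by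
  refine MonoidHom.ext fun a => ?_
  induction a using Quotient.inductionOn with | h f => ?_
  exact congrArg HoClass.mk (ext_loop fun _ => rfl)

theorem pullHom_comp (k' : PtdMap Y' Y'') (k : PtdMap Y Y') (X : PtdSpace.{v}) :
    pullHom (k'.comp k) X = (pullHom k X).comp (pullHom k' X) := by
  refine MonoidHom.ext fun a => ?_
  induction a using Quotient.inductionOn with | h f => ?_
  exact congrArg HoClass.mk (ext_loop fun _ => rfl)

theorem pullHom_const (Y Y' : PtdSpace.{u}) (X : PtdSpace.{v}) :
    pullHom (PtdMap.const Y Y') X = 1 := by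
  refine MonoidHom.ext fun a => ?_
  induction a using Quotient.inductionOn with | h f => ?_
  exact congrArg HoClass.mk (ext_loop fun _ => loop_pt f)

end Susp

namespace HoClass

variable {Y : PtdSpace.{u}} {X : PtdSpace.{v}} {Z : PtdSpace.{w}}

theorem push_mul (k : PtdMap X Z) (a b : HoClass (Susp Y) X) :
    push k (a * b) = push k a * push k b := by
  induction a using Quotient.inductionOn with | h f => ?_
  induction b using Quotient.inductionOn with | h g => ?_
  refine congrArg mk (Susp.ext_loop fun y => Path.ext (funext fun t => ?_))
  change k ((Susp.loop f y).trans (Susp.loop g y) t) =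
    (Susp.loop (k.comp f) y).trans (Susp.loop (k.comp g) y) t
  rw [Path.trans_apply, Path.trans_apply]
  split_ifs <;> rfl

theorem push_pullHom {Y' : PtdSpace.{u}} (k : PtdMap X Z) (j : PtdMap Y Y')
    (a : HoClass (Susp Y') X) : push k (Susp.pullHom j X a) = Susp.pullHom j Z (push k a) := by
  induction a using Quotient.inductionOn with | h f => rfl

end HoClass

namespace Wedge

variable {P : PtdSpace.{u}} {Q : PtdSpace.{v}} {X : PtdSpace.{w}}

/-- The map `P ∨ Q → X` with given restrictions. -/
def desc (f : PtdMap P X) (g : PtdMap Q X) : PtdMap (Wedge P Q) X where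
  toMap := ⟨Quotient.lift (Sum.elim f g) (by
      have hpt : ∀ p ∈ ({Sum.inl P.pt, Sum.inr Q.pt} : Set (P ⊕ Q)), Sum.elim f g p = X.pt := by
        rintro p (rfl | rfl)
        · exact f.map_pt
        · exact g.map_pt
      rintro a b (rfl | ⟨ha, hb⟩)
      · rfl
      · exact (hpt a ha).trans (hpt b hb).symm),
    (f.toMap.continuous.sumElim g.toMap.continuous).quotient_lift _⟩
  map_pt := f.map_pt

theorem hom_ext {f g : PtdMap (Wedge P Q) X} (hl : f.comp (inl P Q) = g.comp (inl P Q))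
    (hr : f.comp (inr P Q) = g.comp (inr P Q)) : f = g := by
  refine PtdMap.ext fun p => ?_
  induction p using Quotient.inductionOn with | h p => ?_
  rcases p with p | p
  · exact congrArg (fun k : PtdMap P X => k p) hl
  · exact congrArg (fun k : PtdMap Q X => k p) hr

theorem homotopic {f g : PtdMap (Wedge P Q) X}
    (hl : (f.comp (inl P Q)).Homotopic (g.comp (inl P Q)))
    (hr : (f.comp (inr P Q)).Homotopic (g.comp (inr P Q))) : f.Homotopic g := by
  obtain ⟨H, hH0, hH1⟩ := PtdMap.homotopic_iff_exists_paths.mp hl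
  obtain ⟨K, hK0, hK1⟩ := PtdMap.homotopic_iff_exists_paths.mp hr
  exact PtdMap.homotopic_iff_exists_paths.mpr
    ⟨desc H K, hom_ext hH0 hK0, hom_ext hH1 hK1⟩

theorem bijective_restrict : Function.Bijective fun c : HoClass (Wedge P Q) X =>
    (HoClass.pull (inl P Q) c, HoClass.pull (inr P Q) c) := by
  constructor
  · intro c d h
    induction c using Quotient.inductionOn with | h f => ?_
    induction d using Quotient.inductionOn with | h g => ?_
    exact Quotient.sound (homotopic (Quotient.exact (congrArg Prod.fst h))
      (Quotient.exact (congrArg Prod.snd h)))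
  · rintro ⟨a, b⟩
    induction a using Quotient.inductionOn with | h f => ?_
    induction b using Quotient.inductionOn with | h g => ?_
    exact ⟨HoClass.mk (desc f g), rfl⟩

end Wedge

theorem PtdMap.isHomotopyEquiv_of_surjective_of_injective {Y : PtdSpace.{u}} {Z : PtdSpace.{v}}
    (h : PtdMap Y Z) (hY : Function.Surjective (HoClass.pull h : HoClass Z Y → HoClass Y Y))
    (hZ : Function.Injective (HoClass.pull h : HoClass Z Z → HoClass Y Z)) :
    h.IsHomotopyEquiv := by
  obtain ⟨k, hk⟩ := hY (HoClass.mk (PtdMap.id Y))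
  induction k using Quotient.inductionOn with | h k => ?_
  have hkh : (k.comp h).Homotopic (PtdMap.id Y) := Quotient.exact hk
  have hhk : HoClass.pull h (HoClass.mk (h.comp k)) = HoClass.pull h (HoClass.mk (PtdMap.id Z)) :=
    Quotient.sound (hkh.comp_left h)
  exact ⟨k, hkh, Quotient.exact (hZ hhk)⟩

section Cofibration

variable {A W Q : PtdSpace.{u}} {i : PtdMap A W} {q : PtdMap W Q} {r : PtdMap W A}

/-- The pointed homotopy extension property of `i : A → W` for targets in a fixed universe:
a homotopy of `f ∘ i` extends along `i` to a homotopy of `f`. -/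
def IsCofibration (i : PtdMap A W) : Prop :=
  ∀ (Z : PtdSpace.{v}) (f : PtdMap W Z) (K : PtdMap A (Paths Z)),
    (Paths.eval Z 0).comp K = f.comp i →
      ∃ E : PtdMap W (Paths Z), (Paths.eval Z 0).comp E = f ∧ E.comp i = K

theorem IsCofibration.down (hi : IsCofibration.{u, max v w} i) : IsCofibration.{u, v} i := by
  intro Z f K hK
  let liftZ : PtdSpace.{max v w} := ⟨ULift.{w} Z, ⟨Z.pt⟩⟩
  let up : PtdMap Z liftZ := ⟨⟨ULift.up, continuous_uliftUp⟩, rfl⟩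
  let down : PtdMap liftZ Z := ⟨⟨ULift.down, continuous_uliftDown⟩, rfl⟩
  obtain ⟨E, hE0, hEi⟩ := hi liftZ (up.comp f) ((Paths.map up).comp K) (congrArg up.comp hK)
  exact ⟨(Paths.map down).comp E, congrArg down.comp hE0, congrArg (Paths.map down).comp hEi⟩

/-- The map `q` exhibits `Q` as the cofiber of `i`, the quotient of `W` by the image of `i`. -/
structure IsCofiber (i : PtdMap A W) (q : PtdMap W Q) : Prop where
  isQuotientMap : Topology.IsQuotientMap q
  eq_iff : ∀ w w', q w = q w' ↔ w = w' ∨ (w ∈ Set.range i ∧ w' ∈ Set.range i)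

namespace IsCofiber

variable {Z : PtdSpace.{v}}

theorem comp_eq_const (hq : IsCofiber i q) : q.comp i = PtdMap.const A Q :=
  PtdMap.ext fun a =>
    ((hq.eq_iff _ _).mpr (Or.inr ⟨⟨a, rfl⟩, ⟨A.pt, i.map_pt⟩⟩)).trans q.map_pt

theorem comp_right_cancel (hq : IsCofiber i q) {f g : PtdMap Q Z} (h : f.comp q = g.comp q) :
    f = g := by
  refine PtdMap.ext fun y => ?_
  obtain ⟨w, rfl⟩ := hq.isQuotientMap.surjective y
  exact congrArg (fun k : PtdMap W Z => k w) h

theorem exists_desc (hq : IsCofiber i q) (f : PtdMap W Z) (hf : f.comp i = PtdMap.const A Z) :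
    ∃ g : PtdMap Q Z, g.comp q = f := by
  have hpt : ∀ w ∈ Set.range i, f w = Z.pt := by
    rintro _ ⟨a, rfl⟩
    exact congrArg (fun k : PtdMap A Z => k a) hf
  have hfib : ∀ w w', q w = q w' → f w = f w' := fun w w' h => by
    rcases (hq.eq_iff w w').mp h with rfl | ⟨hw, hw'⟩
    · rfl
    · rw [hpt w hw, hpt w' hw']
  have hquot : Topology.IsQuotientMap q.toMap := hq.isQuotientMap
  let g : C(Q, Z) := hquot.lift f.toMap hfib
  have hg : ∀ w, g (q w) = f w := DFunLike.congr_fun (hquot.lift_comp f.toMap hfib)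
  exact ⟨⟨g, (congrArg g q.map_pt.symm).trans ((hg W.pt).trans f.map_pt)⟩, PtdMap.ext hg⟩

theorem exists_homotopic_comp (hq : IsCofiber i q) (hi : IsCofibration.{u, v} i)
    {f : PtdMap W Z} (hf : (f.comp i).Homotopic (PtdMap.const A Z)) :
    ∃ g : PtdMap Q Z, f.Homotopic (g.comp q) := by
  obtain ⟨K, hK0, hK1⟩ := PtdMap.homotopic_iff_exists_paths.mp hf
  obtain ⟨E, hE0, hEi⟩ := hi Z f K hK0
  obtain ⟨g, hg⟩ := hq.exists_desc ((Paths.eval Z 1).comp E)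
    ((congrArg (Paths.eval Z 1).comp hEi).trans hK1)
  exact ⟨g, PtdMap.homotopic_iff_exists_paths.mpr ⟨E, hE0, hg.symm⟩⟩

theorem homotopic_of_comp_eq_const (hq : IsCofiber i q) {f g : PtdMap Q Z}
    (H : PtdMap W (Paths Z)) (hH : H.comp i = PtdMap.const A (Paths Z))
    (hf : (Paths.eval Z 0).comp H = f.comp q) (hg : (Paths.eval Z 1).comp H = g.comp q) :
    f.Homotopic g := by
  obtain ⟨H', rfl⟩ := hq.exists_desc H hH
  exact PtdMap.homotopic_iff_exists_paths.mpr
    ⟨H', hq.comp_right_cancel hf, hq.comp_right_cancel hg⟩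

/- The square `E` extending `K` has `H` as its bottom edge, and its other three edges are constant
on `A`; going round these three edges gives the homotopy on `Q`. -/
theorem homotopic_of_contraction (hq : IsCofiber i q) (hi : IsCofibration.{u, v} i)
    {f g : PtdMap Q Z} (H : PtdMap W (Paths Z))
    (hf : (Paths.eval Z 0).comp H = f.comp q) (hg : (Paths.eval Z 1).comp H = g.comp q)
    (K : PtdMap A (Paths (Paths Z))) (hbot : (Paths.eval (Paths Z) 0).comp K = H.comp i)
    (htop : (Paths.eval (Paths Z) 1).comp K = PtdMap.const _ _)
    (hleft : (Paths.map (Paths.eval Z 0)).comp K = PtdMap.const _ _)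
    (hright : (Paths.map (Paths.eval Z 1)).comp K = PtdMap.const _ _) : f.Homotopic g := by
  obtain ⟨E, rfl, rfl⟩ := hi (Paths Z) H K hbot
  let top := (Paths.eval (Paths Z) 1).comp E
  have hdesc (t : I) : ∃ g : PtdMap Q Z, g.comp q = (Paths.eval Z t).comp top :=
    hq.exists_desc _ ((congrArg (Paths.eval Z t).comp htop).trans (PtdMap.comp_const _))
  obtain ⟨f', hf'⟩ := hdesc 0
  obtain ⟨g', hg'⟩ := hdesc 1
  have left : f.Homotopic f' :=
    hq.homotopic_of_comp_eq_const ((Paths.map (Paths.eval Z 0)).comp E) hleft hf hf'.symm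
  have right : g.Homotopic g' :=
    hq.homotopic_of_comp_eq_const ((Paths.map (Paths.eval Z 1)).comp E) hright hg hg'.symm
  exact (left.trans (hq.homotopic_of_comp_eq_const top htop hf'.symm hg'.symm)).trans right.symm

theorem divide_const_homotopic {X : PtdSpace.{v}} (hq : IsCofiber i q)
    (hi : IsCofibration.{u, v} i) (hr : r.comp i = PtdMap.id A) {f g : PtdMap Q (Loops X)}
    (h : (f.comp q).Homotopic (g.comp q)) :
    (Loops.divide f (PtdMap.const _ _)).Homotopic (Loops.divide g (PtdMap.const _ _)) := by
  obtain ⟨H, hHf, hHg⟩ := PtdMap.homotopic_iff_exists_paths.mp h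
  have hHi {k : PtdMap Q (Loops X)} {t : I} (hk : (Paths.eval (Loops X) t).comp H = k.comp q) :
      (Paths.eval (Loops X) t).comp (H.comp i) = PtdMap.const _ _ :=
    calc (Paths.eval (Loops X) t).comp (H.comp i)
        = k.comp (q.comp i) := congrArg (fun f : PtdMap W (Loops X) => f.comp i) hk
      _ = PtdMap.const _ _ := by rw [hq.comp_eq_const, PtdMap.comp_const]
  obtain ⟨L, hL⟩ := Loops.exists_divide_paths H ((H.comp i).comp r)
  have hend {k : PtdMap Q (Loops X)} {t : I} (hk : (Paths.eval (Loops X) t).comp H = k.comp q) :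
      (Paths.eval (Loops X) t).comp L = (Loops.divide k (PtdMap.const _ _)).comp q :=
    calc (Paths.eval (Loops X) t).comp L
        = Loops.divide ((Paths.eval (Loops X) t).comp H)
            (((Paths.eval (Loops X) t).comp (H.comp i)).comp r) := hL t
      _ = Loops.divide (k.comp q) ((PtdMap.const A (Loops X)).comp r) := by rw [hk, hHi hk]
      _ = (Loops.divide k (PtdMap.const _ _)).comp q := rfl
  obtain ⟨K, hK, hK1, hleft, hright⟩ :=
    Loops.exists_contraction_divide_self (H.comp i) (hHi hHf) (hHi hHg)
  have hbot : (Paths.eval _ 0).comp K = L.comp i := Paths.hom_ext fun t => by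
    let k := (Paths.eval (Loops X) t).comp (H.comp i)
    calc (Paths.eval (Loops X) t).comp ((Paths.eval _ 0).comp K)
        = Loops.divide k (k.comp (PtdMap.id A)) := hK t
      _ = Loops.divide k (k.comp (r.comp i)) := by rw [hr]
      _ = (Paths.eval (Loops X) t).comp (L.comp i) := (congrArg (fun d => d.comp i) (hL t)).symm
  exact hq.homotopic_of_contraction hi L (hend hHf) (hend hHg) K hbot hK1 hleft hright

theorem pullHom_injective (hq : IsCofiber i q) (hi : IsCofibration.{u, v} i)
    (hr : r.comp i = PtdMap.id A) (X : PtdSpace.{v}) :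
    Function.Injective (Susp.pullHom q X) := by
  intro a b hab
  induction a using Quotient.inductionOn with | h F => ?_
  induction b using Quotient.inductionOn with | h G => ?_
  have hpull : (F.comp (Susp.map q)).Homotopic (G.comp (Susp.map q)) := Quotient.exact hab
  have hloop : ((Susp.loopEquiv F).comp q).Homotopic ((Susp.loopEquiv G).comp q) :=
    Susp.homotopic_iff_loopEquiv.mp hpull
  have hdiv : (Susp.mulMap F (Susp.invMap (PtdMap.const _ _))).Homotopic
      (Susp.mulMap G (Susp.invMap (PtdMap.const _ _))) := by
    rw [Susp.homotopic_iff_loopEquiv, Loops.loopEquiv_mulMap_invMap,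
      Loops.loopEquiv_mulMap_invMap]
    exact hq.divide_const_homotopic hi hr hloop
  have hmul : HoClass.mk F * (1 : HoClass (Susp Q) X)⁻¹ =
      HoClass.mk G * (1 : HoClass (Susp Q) X)⁻¹ := Quotient.sound hdiv
  exact mul_right_cancel hmul

theorem range_pullHom (hq : IsCofiber i q) (hi : IsCofibration.{u, v} i) (X : PtdSpace.{v}) :
    (Susp.pullHom q X).range = (Susp.pullHom i X).ker := by
  refine le_antisymm ?_ fun b hb => ?_
  · rintro _ ⟨a, rfl⟩
    have h : (Susp.pullHom i X).comp (Susp.pullHom q X) = 1 := by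
      rw [← Susp.pullHom_comp, hq.comp_eq_const, Susp.pullHom_const]
    exact DFunLike.congr_fun h a
  · induction b using Quotient.inductionOn with | h F => ?_
    have hpull : (F.comp (Susp.map i)).Homotopic (PtdMap.const _ _) := Quotient.exact hb
    have hloop : ((Susp.loopEquiv F).comp i).Homotopic (PtdMap.const _ _) :=
      Susp.homotopic_iff_loopEquiv.mp hpull
    obtain ⟨g, hg⟩ := hq.exists_homotopic_comp hi hloop
    exact ⟨HoClass.mk (Susp.loopEquiv.symm g),
      Quotient.sound (Susp.homotopic_iff_loopEquiv.mpr hg).symm⟩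

end IsCofiber

theorem pullHom_comp_pullHom_of_retraction (hr : r.comp i = PtdMap.id A) (X : PtdSpace.{v}) :
    (Susp.pullHom i X).comp (Susp.pullHom r X) = MonoidHom.id _ := by
  rw [← Susp.pullHom_comp, hr, Susp.pullHom_id]

/-- The split extension `[ΣQ, X] → [ΣW, X] → [ΣA, X]` of a retractable cofibration `A → W` with
cofiber `Q`. -/
noncomputable def cofiberExtension (hi : IsCofibration.{u, v} i) (hq : IsCofiber i q)
    (hr : r.comp i = PtdMap.id A) (X : PtdSpace.{v}) :
    GroupExtension (HoClass (Susp Q) X) (HoClass (Susp W) X) (HoClass (Susp A) X) where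
  inl := Susp.pullHom q X
  rightHom := Susp.pullHom i X
  inl_injective := hq.pullHom_injective hi hr X
  range_inl_eq_ker_rightHom := hq.range_pullHom hi X
  rightHom_surjective b :=
    ⟨_, DFunLike.congr_fun (pullHom_comp_pullHom_of_retraction hr X) b⟩

/-- The splitting of `cofiberExtension` given by the retraction. -/
noncomputable def cofiberSplitting (hi : IsCofibration.{u, v} i) (hq : IsCofiber i q)
    (hr : r.comp i = PtdMap.id A) (X : PtdSpace.{v}) : (cofiberExtension hi hq hr X).Splitting where
  toMonoidHom := Susp.pullHom r X
  rightInverse_rightHom := DFunLike.congr_fun (pullHom_comp_pullHom_of_retraction hr X)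

/-- The isomorphism `[ΣQ, X] ⋊ [ΣA, X] ≃ [ΣW, X]` given by `cofiberSplitting`. -/
noncomputable abbrev cofiberEquiv (hi : IsCofibration.{u, v} i) (hq : IsCofiber i q)
    (hr : r.comp i = PtdMap.id A) (X : PtdSpace.{v}) :
    HoClass (Susp Q) X ⋊[(cofiberSplitting hi hq hr X).conjAct] HoClass (Susp A) X ≃*
      HoClass (Susp W) X :=
  (cofiberSplitting hi hq hr X).semidirectProductMulEquiv

theorem cofiberEquiv_apply (hi : IsCofibration.{u, v} i) (hq : IsCofiber i q)
    (hr : r.comp i = PtdMap.id A) {X : PtdSpace.{v}} (a : HoClass (Susp Q) X)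
    (b : HoClass (Susp A) X) :
    cofiberEquiv hi hq hr X ⟨a, b⟩ = Susp.pullHom q X a * Susp.pullHom r X b := rfl

theorem push_cofiberEquiv (hi : IsCofibration.{u, v} i) (hq : IsCofiber i q)
    (hr : r.comp i = PtdMap.id A) {X X' : PtdSpace.{v}} (k : PtdMap X X')
    (a : HoClass (Susp Q) X) (b : HoClass (Susp A) X) :
    HoClass.push k (cofiberEquiv hi hq hr X ⟨a, b⟩) =
      cofiberEquiv hi hq hr X' ⟨HoClass.push k a, HoClass.push k b⟩ := by
  rw [cofiberEquiv_apply, cofiberEquiv_apply, HoClass.push_mul, HoClass.push_pullHom,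
    HoClass.push_pullHom]

/-- The comparison map `ΣW → ΣQ ∨ ΣA`, the sum of `Σq` and `Σr`. -/
noncomputable def wedgeMap (q : PtdMap W Q) (r : PtdMap W A) :
    PtdMap (Susp W) (Wedge (Susp Q) (Susp A)) :=
  Susp.mulMap ((Wedge.inl _ _).comp (Susp.map q)) ((Wedge.inr _ _).comp (Susp.map r))

theorem pull_wedgeMap {X : PtdSpace.{v}} (c : HoClass (Wedge (Susp Q) (Susp A)) X) :
    HoClass.pull (wedgeMap q r) c = Susp.pullHom q X (HoClass.pull (Wedge.inl _ _) c) *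
      Susp.pullHom r X (HoClass.pull (Wedge.inr _ _) c) := by
  induction c using Quotient.inductionOn with | h f => ?_
  exact HoClass.push_mul f (HoClass.mk ((Wedge.inl _ _).comp (Susp.map q)))
    (HoClass.mk ((Wedge.inr _ _).comp (Susp.map r)))

theorem bijective_pull_wedgeMap (hi : IsCofibration.{u, v} i) (hq : IsCofiber i q)
    (hr : r.comp i = PtdMap.id A) (X : PtdSpace.{v}) :
    Function.Bijective
      (HoClass.pull (wedgeMap q r) : HoClass (Wedge (Susp Q) (Susp A)) X → _) := by
  have h := ((cofiberEquiv hi hq hr X).bijective.comp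
    SemidirectProduct.equivProd.symm.bijective).comp Wedge.bijective_restrict
  exact (funext pull_wedgeMap : HoClass.pull (wedgeMap q r) = _) ▸ h

theorem isHomotopyEquiv_wedgeMap (hi : IsCofibration.{u, u} i) (hq : IsCofiber i q)
    (hr : r.comp i = PtdMap.id A) : (wedgeMap q r).IsHomotopyEquiv :=
  PtdMap.isHomotopyEquiv_of_surjective_of_injective _
    (bijective_pull_wedgeMap hi hq hr _).surjective (bijective_pull_wedgeMap hi hq hr _).injective

end Cofibration

section Circle

theorem coe_circleParam_coe (t : ℝ) : (circleParam (t : UnitAddCircle) : ℝ) = Int.fract t := by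
  change (AddCircle.equivIco (1 : ℝ) 0 (QuotientAddGroup.mk t) : ℝ) = _
  rw [AddCircle.coe_equivIco_mk_apply, div_one, mul_one]

theorem circleParam_zero : circleParam 0 = 0 :=
  Subtype.ext ((coe_circleParam_coe 0).trans Int.fract_zero)

theorem coe_circleParam (z : UnitAddCircle) : ((circleParam z : ℝ) : UnitAddCircle) = z :=
  (AddCircle.equivIco (1 : ℝ) 0).symm_apply_apply z

theorem circleParam_eq_zero_or_one_iff {z : UnitAddCircle} :
    circleParam z = 0 ∨ circleParam z = 1 ↔ z = 0 := by
  refine ⟨?_, fun h => Or.inl (h ▸ circleParam_zero)⟩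
  rintro (h | h)
  · rw [← coe_circleParam z, h]
    exact AddCircle.coe_zero (p := (1 : ℝ))
  · rw [← coe_circleParam z, h]
    exact AddCircle.coe_period (1 : ℝ)

theorem apply_circleParam_coe {T : Type*} {G : I → T} (h01 : G 0 = G 1) (t : I) :
    G (circleParam (t : ℝ)) = G t := by
  obtain rfl | ht := eq_or_ne t 1
  · rw [← h01]
    exact congrArg G (Subtype.ext ((coe_circleParam_coe 1).trans Int.fract_one))
  · refine congrArg G (Subtype.ext ((coe_circleParam_coe t).trans ?_))
    exact Int.fract_eq_self.mpr ⟨t.2.1, lt_of_le_of_ne t.2.2 fun h => ht (Subtype.ext h)⟩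

theorem continuous_comp_circleParam {P T : Type*} [TopologicalSpace P] [TopologicalSpace T]
    {G : P × I → T} (hG : Continuous G) (h01 : ∀ p, G (p, 0) = G (p, 1)) :
    Continuous fun x : P × UnitAddCircle => G (x.1, circleParam x.2) := by
  have hquot : IsOpenQuotientMap
      (Prod.map id ((↑) : ℝ → UnitAddCircle) : P × ℝ → P × UnitAddCircle) :=
    IsOpenQuotientMap.id.prodMap QuotientAddGroup.isOpenQuotientMap_mk
  refine hquot.isQuotientMap.continuous_iff.mpr ?_
  let F : P → ℝ → T := fun p t => G (p, Set.projIcc 0 1 zero_le_one t)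
  have hF : Continuous (Function.uncurry F) :=
    hG.comp (continuous_id.prodMap continuous_projIcc)
  have hF01 (p : P) : F p 0 = F p 1 := by
    simp only [F, Set.projIcc_left, Set.projIcc_right]
    exact h01 p
  convert ContinuousOn.comp_fract' hF.continuousOn hF01 using 1
  funext x
  change G (x.1, circleParam (x.2 : UnitAddCircle)) = G (x.1, Set.projIcc 0 1 zero_le_one _)
  rw [← coe_circleParam_coe, Set.projIcc_val]

section HomotopyExtension

variable {A : Type u} {Z : Type v} [TopologicalSpace A] [TopologicalSpace Z]
  (f : C(A × UnitAddCircle, Z)) (K : C(A × I, Z)) (hK : ∀ a, K (a, 0) = f (a, 0))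

include hK in
theorem exists_collar_extension :
    ∃ F : C(A × ℝ, Z), (∀ a (t : I), F (a, t) = f (a, (t : ℝ))) ∧
      ∀ a (s : I), F (a, -s) = K (a, s) ∧ F (a, 1 + s) = K (a, s) := by
  let d : ℝ → ℝ := fun τ => max (-τ) (τ - 1)
  have hd_neg (s : I) : d (-s) = s := max_eq_iff.mpr (Or.inl ⟨neg_neg _, by linarith [s.2.1]⟩)
  have hd_add (s : I) : d (1 + s) = s := max_eq_iff.mpr (Or.inr ⟨by ring, by linarith [s.2.1]⟩)
  let F : A × ℝ → Z := fun p => if d p.2 ≤ 0 then f (p.1, p.2)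
    else K (p.1, Set.projIcc 0 1 zero_le_one (d p.2))
  have hd_zero (a : A) {τ : ℝ} (hτ : d τ = 0) :
      f (a, τ) = K (a, Set.projIcc 0 1 zero_le_one (d τ)) := by
    have hτ' : (τ : UnitAddCircle) = 0 := by
      rcases max_eq_iff.mp hτ with ⟨h, -⟩ | ⟨h, -⟩
      · rw [neg_eq_zero.mp h, AddCircle.coe_zero]
      · rw [sub_eq_zero.mp h, AddCircle.coe_period (1 : ℝ)]
    rw [hτ, hτ', Set.projIcc_left]
    exact (hK a).symm
  have hF_collar (a : A) {τ : ℝ} {s : I} (hτ : d τ = s) : F (a, τ) = K (a, s) := by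
    have hproj : Set.projIcc 0 1 zero_le_one (d τ) = s := by rw [hτ, Set.projIcc_val]
    by_cases h : d τ ≤ 0
    · have hs : d τ = 0 := le_antisymm h (hτ ▸ s.2.1)
      exact (if_pos h).trans ((hd_zero a hs).trans (by rw [hproj]))
    · exact (if_neg h).trans (by rw [hproj])
  refine ⟨⟨F, ?_⟩, fun a t => if_pos (max_le (by linarith [t.2.1]) (by linarith [t.2.2])),
    fun a s => ⟨hF_collar a (hd_neg s), hF_collar a (hd_add s)⟩⟩
  exact Continuous.if_le (by fun_prop)
    (K.continuous.comp (continuous_fst.prodMk (continuous_projIcc.comp (by fun_prop))))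
    (by fun_prop) continuous_const fun p hp => hd_zero p.1 hp

include hK in
/- Cut the circle open to `[0, 1]` and attach the homotopy as a collar at both ends; at time `s` the
circle runs through `[-s, 1 + s]`. -/
theorem exists_homotopy_extension_circle :
    ∃ E : C((A × UnitAddCircle) × I, Z),
      (∀ x, E (x, 0) = f x) ∧ ∀ a s, E ((a, 0), s) = K (a, s) := by
  obtain ⟨F, hf, hF⟩ := exists_collar_extension f K hK
  let G : (A × I) × I → Z := fun p => F (p.1.1, p.2 + p.1.2 * (2 * p.2 - 1))
  have hG0 (a : A) (s : I) : G ((a, s), 0) = K (a, s) := by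
    rw [← (hF a s).1]
    exact congrArg (fun τ : ℝ => F (a, τ)) (by simp)
  have hG1 (a : A) (s : I) : G ((a, s), 1) = K (a, s) := by
    rw [← (hF a s).2]
    exact congrArg (fun τ : ℝ => F (a, τ)) (by simp only [Set.Icc.coe_one]; ring)
  have hG : Continuous G := by fun_prop
  have hE : Continuous fun p : (A × UnitAddCircle) × I => G ((p.1.1, p.2), circleParam p.1.2) :=
    (continuous_comp_circleParam hG fun p => (hG0 p.1 p.2).trans (hG1 p.1 p.2).symm).comp
      (f := fun p : (A × UnitAddCircle) × I => ((p.1.1, p.2), p.1.2)) (by fun_prop)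
  refine ⟨⟨_, hE⟩, fun ⟨a, z⟩ => ?_, fun a s => ?_⟩
  · calc G ((a, 0), circleParam z)
        = F (a, circleParam z) := congrArg (fun τ : ℝ => F (a, τ)) (by simp)
      _ = f (a, z) := by rw [hf, coe_circleParam]
  · calc G ((a, s), circleParam 0) = G ((a, s), 0) := by rw [circleParam_zero]
      _ = K (a, s) := hG0 a s

end HomotopyExtension

end Circle

/-- The pointed map `W ⊔ * → Z` that extends a map `W → Z`. -/
def AddPt.desc {W : Type u} [TopologicalSpace W] {Z : PtdSpace.{v}} (g : C(W, Z)) :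
    PtdMap (AddPt W) Z where
  toMap := ⟨Sum.elim g fun _ => Z.pt, g.continuous.sumElim continuous_const⟩
  map_pt := rfl

section CircleProduct

variable {W A : Type u} [TopologicalSpace W] [TopologicalSpace A] (e : W ≃ₜ A × UnitAddCircle)

/-- The projection `W → A` of a product `W ≅ A × S¹`. -/
def circleProj : C(W, A) := ⟨fun x => (e x).1, by fun_prop⟩

/-- The inclusion `A → W`, `a ↦ (a, 0)`, into a product `W ≅ A × S¹`. -/
def circleIncl : C(A, W) := ⟨fun a => e.symm (a, 0), by fun_prop⟩

/-- The collapse `W ⊔ * → Σ(A ⊔ *)`, `(a, z) ↦ [a, z]`, for a product `W ≅ A × S¹`. -/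
noncomputable def circleCollapse : PtdMap (AddPt W) (Susp (AddPt A)) :=
  AddPt.desc ⟨fun x => Susp.point (AddPt A) (Sum.inl (e x).1) (circleParam (e x).2),
    (continuous_point_circleParam (AddPt A)).comp
      (f := fun x => ((Sum.inl (e x).1 : AddPt A), (e x).2))
      ((continuous_inl.comp (circleProj e).continuous).prodMk e.continuous.snd)⟩

theorem map_circleProj_comp_map_circleIncl :
    (AddPt.map (circleProj e)).comp (AddPt.map (circleIncl e)) = PtdMap.id (AddPt A) := by
  refine PtdMap.ext fun y => ?_
  rcases y with a | ⟨⟩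
  · exact congrArg (fun p : A × UnitAddCircle => Sum.inl p.1) (e.apply_symm_apply (a, 0))
  · rfl

theorem isCofibration_map_circleIncl :
    IsCofibration.{u, v} (AddPt.map (circleIncl e)) := by
  intro Z f K hK
  have hK' (y : AddPt A) : Paths.eval Z 0 (K y) = f (AddPt.map (circleIncl e) y) :=
    congrArg (fun k : PtdMap (AddPt A) Z => k y) hK
  let f' : C(A × UnitAddCircle, Z) :=
    ⟨fun p => f (Sum.inl (e.symm p)), f.toMap.continuous.comp (by fun_prop)⟩
  let K' : C(A × I, Z) := ⟨fun p => Paths.eval Z p.2 (K (Sum.inl p.1)),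
    (Paths.continuous_eval Z).comp
      ((K.toMap.continuous.comp (continuous_inl.comp continuous_fst)).prodMk continuous_snd)⟩
  obtain ⟨E, hE0, hEi⟩ := exists_homotopy_extension_circle f' K' fun a => hK' (Sum.inl a)
  let E' : C(W, Paths Z) :=
    (E.comp ((e : C(W, A × UnitAddCircle)).prodMap (ContinuousMap.id I))).curry
  refine ⟨AddPt.desc E', PtdMap.ext ?_, Paths.hom_ext fun t => PtdMap.ext ?_⟩
  · rintro (x | ⟨⟩)
    · refine (hE0 (e x)).trans ?_
      exact congrArg (fun x => f (Sum.inl x)) (e.symm_apply_apply x)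
    · exact f.map_pt.symm
  · rintro (a | ⟨⟩)
    · refine Eq.trans ?_ (hEi a t)
      exact congrArg (fun p => E (p, t)) (e.apply_symm_apply (a, 0))
    · exact ((Paths.eval Z t).comp K).map_pt.symm

/-- The representative in `(A ⊔ *) × [0, 1]` of the image of a point under `circleCollapse`. -/
noncomputable def circleCoord : AddPt W → AddPt A × I :=
  Sum.elim (fun x => (Sum.inl (e x).1, circleParam (e x).2)) fun _ => (Sum.inr (), 0)

theorem circleCollapse_eq_mk (x : AddPt W) :
    circleCollapse e x = Quotient.mk (collapseSetoid (suspSet (AddPt A))) (circleCoord e x) := by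
  rcases x with x | ⟨⟩ <;> rfl

theorem circleCoord_injective : Function.Injective (circleCoord e) := by
  refine Function.Injective.sumElim (fun x y h => e.injective ?_) (fun _ _ _ => rfl) ?_
  · obtain ⟨h1, h2⟩ := Prod.mk.inj h
    refine Prod.ext (Sum.inl_injective h1) ?_
    rw [← coe_circleParam (e x).2, h2, coe_circleParam]
  · intro x _ h
    exact Sum.inl_ne_inr (congrArg Prod.fst h)

theorem circleCoord_mem_suspSet_iff {x : AddPt W} :
    circleCoord e x ∈ suspSet (AddPt A) ↔ x ∈ Set.range (AddPt.map (circleIncl e)) := by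
  rcases x with x | ⟨⟩
  · calc circleCoord e (Sum.inl x) ∈ suspSet (AddPt A)
        ↔ circleParam (e x).2 = 0 ∨ circleParam (e x).2 = 1 := or_iff_right Sum.inl_ne_inr
      _ ↔ (e x).2 = 0 := circleParam_eq_zero_or_one_iff
      _ ↔ Sum.inl x ∈ Set.range (AddPt.map (circleIncl e)) := by
        constructor
        · intro h
          exact ⟨Sum.inl (e x).1, congrArg Sum.inl (e.symm_apply_eq.mpr (Prod.ext rfl h.symm))⟩
        · rintro ⟨a | ⟨⟩, h⟩
          · have hx : e.symm (a, 0) = x := Sum.inl_injective h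
            rw [← hx, e.apply_symm_apply]
          · exact (Sum.inr_ne_inl h).elim
  · exact iff_of_true (Or.inl rfl) ⟨Sum.inr (), rfl⟩

theorem circleCollapse_eq_iff {x y : AddPt W} :
    circleCollapse e x = circleCollapse e y ↔
      x = y ∨ x ∈ Set.range (AddPt.map (circleIncl e)) ∧
        y ∈ Set.range (AddPt.map (circleIncl e)) := by
  rw [circleCollapse_eq_mk, circleCollapse_eq_mk]
  refine (Quotient.eq (r := collapseSetoid (suspSet (AddPt A)))).trans ?_
  exact or_congr (circleCoord_injective e).eq_iff
    (and_congr (circleCoord_mem_suspSet_iff e) (circleCoord_mem_suspSet_iff e))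

theorem isQuotientMap_circleCollapse : Topology.IsQuotientMap (circleCollapse e) := by
  let P : PtdMap (AddPt A) (Paths (AddPt W)) :=
    AddPt.desc (ContinuousMap.curry ⟨fun p : A × I => Sum.inl (e.symm (p.1, (p.2 : ℝ))),
      continuous_inl.comp (by fun_prop)⟩)
  let p : AddPt A × I → AddPt W := fun y => Paths.eval _ y.2 (P y.1)
  have hp : Continuous p :=
    (Paths.continuous_eval _).comp (P.toMap.continuous.prodMap continuous_id)
  have hcomp : circleCollapse e ∘ p = Quotient.mk (collapseSetoid (suspSet (AddPt A))) := by
    funext ⟨y, t⟩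
    rcases y with a | ⟨⟩
    · let G (t : I) := Susp.point (AddPt A) (Sum.inl a) t
      have hG : G 0 = G 1 :=
        (Susp.point_eq_pt (Or.inr (Or.inl rfl))).trans
          (Susp.point_eq_pt (Or.inr (Or.inr rfl))).symm
      calc circleCollapse e (Sum.inl (e.symm (a, ↑(t : ℝ))))
          = G (circleParam (t : ℝ)) :=
            congrArg
              (fun x : A × UnitAddCircle => Susp.point (AddPt A) (Sum.inl x.1) (circleParam x.2))
              (e.apply_symm_apply (a, ↑(t : ℝ)))
        _ = G t := apply_circleParam_coe hG t
    · exact (Susp.point_eq_pt (Or.inl rfl)).symm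
  refine Topology.IsQuotientMap.of_comp hp (circleCollapse e).toMap.continuous ?_
  rw [hcomp]
  exact isQuotientMap_quotient_mk'

theorem isCofiber_circleCollapse : IsCofiber (AddPt.map (circleIncl e)) (circleCollapse e) where
  isQuotientMap := isQuotientMap_circleCollapse e
  eq_iff _ _ := circleCollapse_eq_iff e

end CircleProduct

/-- The homeomorphism `T^{n-1} ≅ T^{n-2} × S¹` that splits off the last coordinate. -/
def torusSplit (n : ℕ) (hn : 1 < n) : Torus (n - 1) ≃ₜ Torus (n - 1 - 1) × UnitAddCircle where
  toFun x := (torusProj n x, torusLast n hn x)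
  invFun p i := if h : (i : ℕ) < n - 1 - 1 then p.1 ⟨i, h⟩ else p.2
  left_inv x := by
    funext i
    by_cases h : (i : ℕ) < n - 1 - 1
    · exact dif_pos h
    · have hlast : (⟨n - 1 - 1, by lia⟩ : Fin (n - 1)) = i := Fin.ext (by lia)
      exact (dif_neg h).trans (congrArg x hlast)
  right_inv p := Prod.ext (funext fun i => dif_pos i.2) (dif_neg (lt_irrefl _))
  continuous_toFun := (torusProj n).continuous.prodMk (continuous_apply _)
  continuous_invFun := by
    refine continuous_pi fun i => ?_
    split_ifs <;> fun_prop

theorem isCofibration_map_torusIncl (n : ℕ) (hn : 1 < n) :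
    IsCofibration.{0, u} (AddPt.map (torusIncl n)) :=
  isCofibration_map_circleIncl (torusSplit n hn)

theorem isCofiber_torusCollapse (n : ℕ) (hn : 1 < n) :
    IsCofiber (AddPt.map (torusIncl n)) (torusCollapse n hn) :=
  isCofiber_circleCollapse (torusSplit n hn)

theorem map_torusProj_comp_map_torusIncl (n : ℕ) (hn : 1 < n) :
    (AddPt.map (torusProj n)).comp (AddPt.map (torusIncl n)) = PtdMap.id _ :=
  map_circleProj_comp_map_circleIncl (torusSplit n hn)

end FoxTorus

theorem proposition1_general {A W Q : PtdSpace.{u}} {i : PtdMap A W} {q : PtdMap W Q}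
    {r : PtdMap W A} (hi : IsCofibration.{u, max u v} i) (hq : IsCofiber i q)
    (hr : r.comp i = PtdMap.id A) :
    ∃ h : PtdMap (Susp W) (Wedge (Susp Q) (Susp A)),
      h.IsHomotopyEquiv ∧
      (∀ X : PtdSpace.{v},
        Function.Injective (Susp.pullHom q X) ∧
        (Susp.pullHom q X).range = (Susp.pullHom i X).ker ∧
        (Susp.pullHom i X).comp (Susp.pullHom r X) = MonoidHom.id _) ∧
      ∃ (φ : ∀ X : PtdSpace.{v}, HoClass (Susp A) X →* MulAut (HoClass (Susp Q) X))
        (Θ : ∀ X : PtdSpace.{v},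
          HoClass (Susp Q) X ⋊[φ X] HoClass (Susp A) X ≃* HoClass (Susp W) X),
        (∀ (X : PtdSpace.{v}) (a : HoClass (Susp Q) X) (b : HoClass (Susp A) X),
          Θ X ⟨a, b⟩ = Susp.pullHom q X a * Susp.pullHom r X b) ∧
        (∀ (X X' : PtdSpace.{v}) (k : PtdMap X X') (a : HoClass (Susp Q) X)
          (b : HoClass (Susp A) X),
          HoClass.push k (Θ X ⟨a, b⟩) = Θ X' ⟨HoClass.push k a, HoClass.push k b⟩) ∧
        (∀ (X : PtdSpace.{v}) (c : HoClass (Wedge (Susp Q) (Susp A)) X),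
          HoClass.pull h c =
            Θ X ⟨HoClass.pull (Wedge.inl _ _) c, HoClass.pull (Wedge.inr _ _) c⟩) := by
  have hi_u : IsCofibration.{u, u} i := IsCofibration.down.{u, u, v} hi
  have hi_v : IsCofibration.{u, v} i := IsCofibration.down.{u, v, u} hi
  exact ⟨wedgeMap q r, isHomotopyEquiv_wedgeMap hi_u hq hr,
    fun X => ⟨hq.pullHom_injective hi_v hr X, hq.range_pullHom hi_v X,
      pullHom_comp_pullHom_of_retraction hr X⟩,
    fun X => (cofiberSplitting hi_v hq hr X).conjAct, cofiberEquiv hi_v hq hr,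
    fun _ => cofiberEquiv_apply hi_v hq hr, fun _ _ => push_cofiberEquiv hi_v hq hr,
    fun _ => pull_wedgeMap⟩

theorem proposition1 (n : ℕ) (hn : 1 < n) :
    ∃ h : PtdMap (FoxSpace n)
        (Wedge (Susp (FoxSpace (n - 1))) (FoxSpace (n - 1))),
      -- `h : F_n → ΣF_{n-1} ∨ F_{n-1}` is a pointed homotopy equivalence
      h.IsHomotopyEquiv ∧
      -- `1 → [ΣF_{n-1}, X] → [F_n, X] → [F_{n-1}, X] → 1` is split exact for every `X`
      (∀ X : PtdSpace.{u},
        Function.Injective (foxKernelMap n hn X) ∧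
        (foxKernelMap n hn X).range = (foxRestrict n X).ker ∧
        (foxRestrict n X).comp (foxSection n X) = MonoidHom.id _) ∧
      -- the resulting isomorphism `Θ` of `[ΣF_{n-1}, X] ⋊ [F_{n-1}, X]` with `[F_n, X]`
      ∃ (φ : ∀ X : PtdSpace.{u}, HoClass (FoxSpace (n - 1)) X →*
            MulAut (HoClass (Susp (FoxSpace (n - 1))) X))
        (Θ : ∀ X : PtdSpace.{u},
          HoClass (Susp (FoxSpace (n - 1))) X ⋊[φ X]
            HoClass (FoxSpace (n - 1)) X ≃*
          HoClass (FoxSpace n) X),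
        (∀ (X : PtdSpace.{u})
          (a : HoClass (Susp (FoxSpace (n - 1))) X)
          (b : HoClass (FoxSpace (n - 1)) X),
          Θ X ⟨a, b⟩ = foxKernelMap n hn X a * foxSection n X b) ∧
        -- `Θ` is natural in `X`
        (∀ (X X' : PtdSpace.{u}) (k : PtdMap X X')
          (a : HoClass (Susp (FoxSpace (n - 1))) X)
          (b : HoClass (FoxSpace (n - 1)) X),
          HoClass.push k (Θ X ⟨a, b⟩) =
            Θ X' ⟨HoClass.push k a, HoClass.push k b⟩) ∧
        -- `h^*` is `Θ` under `[ΣF_{n-1} ∨ F_{n-1}, X] = [ΣF_{n-1}, X] × [F_{n-1}, X]`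
        (∀ (X : PtdSpace.{u})
          (c : HoClass (Wedge (Susp (FoxSpace (n - 1)))
            (FoxSpace (n - 1))) X),
          HoClass.pull h c =
            Θ X ⟨HoClass.pull (Wedge.inl _ _) c,
              HoClass.pull (Wedge.inr _ _) c⟩) :=
  proposition1_general (isCofibration_map_torusIncl n hn) (isCofiber_torusCollapse n hn)
    (map_torusProj_comp_map_torusIncl n hn)
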